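/- A black-box is a list \(X=(x_0,\dots,x_{N-1})\in\{0,1\}^N\), \(N\ge 1\) (for an RP-machine on a fixed input: \(x_j\) is its answer on the \(j\)-th random string), with the promise that \(X\) contains either no ones or at least \(N/2\) ones. An algorithm has to reject in the first case and to accept in the second. A quantum network with \(T\) queries applies \(U_T O\,U_{T-1}O\cdots O\,U_1 O\,U_0\) to \(|\bar 0\rangle\), where the \(U_i\) are unitary operations on a fixed finite number of qubits, independent of \(X\), and \(O\) is the query gate \(|j,b,z\rangle\mapsto|j,b\oplus x_j,z\rangle\) (with \(j\) ranging over a register large enough for all \(N\) indices, and \(O\) acting as the identity if \(j\ge N\)); then one fixed qubit is observed, and the network accepts iff the outcome is \(1\). Its worst-case error \(\varepsilon\) is the largest probability of a wrong answer over all \(X\) that satisfy the promise. 1. For every constant \(b>0\) there is a constant \(C>0\) such that, for all integers \(N\ge 1\) and \(0\le T\le N/2\), every quantum network with \(T\) queries to black-boxes of \(N\) items has worst-case error \[ \varepsilon\;\ge\; C\exp\!\left(-\frac{8bT^2}{N}-8\sqrt2\,T\right). \] 2. There is a constant \(c>0\) such that, for all integers \(k\ge 2\) and \(N\ge k\), every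 quantum network with worst-case error \(\varepsilon\le 2^{-k}\) on black-boxes of \(N\) items makes \(T\ge ck\) queries. The same holds, with the same \(c\), for all \(k\ge 0\) and \(N\ge k\) for networks that never accept the black-box without ones. 3. In comparison, for all integers \(N\ge1\) and \(k\ge0\) there is a classical randomized algorithm (a probability distribution on decision trees of depth at most \(k\)) that makes at most \(k\) queries, never accepts the black-box without ones, and has worst-case error at most \(2^{-k}\). Hence the quantum speed-up is at most linear. -/

import Mathlib

/-- A black-box of `N` items, i.e. a list `X = (x_0, …, x_{N-1})` of `N` bits. -/
abbrev BlackBox (N : ℕ) : Type := Fin N → Bool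

namespace BlackBox

/-- The number of ones of a black-box. -/
def ones {N : ℕ} (X : BlackBox N) : ℕ := (Finset.univ.filter fun i => X i = true).card

/-- The promise given by an RP-machine: no ones at all, or at least `N / 2` ones. -/
def RPPromise {N : ℕ} (X : BlackBox N) : Prop := X.ones = 0 ∨ (N : ℝ) / 2 ≤ (X.ones : ℝ)

/-- The black-box without ones. -/
def zero (N : ℕ) : BlackBox N := fun _ => false

/-- The error probability, on `X`, of an algorithm with acceptance probabilities `p`: it should
reject the black-box without ones and accept a black-box that contains a one. -/
noncomputable def errorProb {N : ℕ} (p : BlackBox N → ℝ) (X : BlackBox N) : ℝ :=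
  if X.ones = 0 then p X else 1 - p X

/-- The error probability on the worst black-box that satisfies the promise (a supremum over a
finite nonempty set). -/
noncomputable def worstCaseError {N : ℕ} (p : BlackBox N → ℝ) : ℝ :=
  ⨆ X : {X : BlackBox N // X.RPPromise}, errorProb p X.1

end BlackBox

/-- Classical basis states `|j, b, z⟩`: an index register of `n` qubits, an answer qubit and
`w` work qubits. -/
abbrev BasisState (n w : ℕ) : Type := BitVec n × Bool × BitVec w

/-- The action of a query on basis states: `|j, b, z⟩ ↦ |j, b ⊕ x_j, z⟩`; bitstrings `j` that are
not the index of an item are left alone. -/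
def queryMap {N : ℕ} (X : BlackBox N) {n w : ℕ} (s : BasisState n w) : BasisState n w :=
  (s.1, if h : s.1.toNat < N then xor s.2.1 (X ⟨s.1.toNat, h⟩) else s.2.1, s.2.2)

/-- The query gate `O`, as a matrix. -/
def queryGate {N : ℕ} (X : BlackBox N) (n w : ℕ) :
    Matrix (BasisState n w) (BasisState n w) ℂ :=
  fun r s => if r = queryMap X s then 1 else 0

/-- A quantum gate network that makes `T` queries to a black-box of `N` items: unitary operations
`U_0, …, U_T`, which do not depend on the black-box, on `n + 1 + w` qubits, where the `n` qubits
of the index register suffice to address all items. -/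
structure QuantumNetwork (N T : ℕ) where
  n : ℕ
  w : ℕ
  le_two_pow : N ≤ 2 ^ n
  U : Fin (T + 1) → Matrix.unitaryGroup (BasisState n w) ℂ

namespace QuantumNetwork

variable {N T : ℕ} (A : QuantumNetwork N T)

/-- The transformation `U_T O U_{T-1} O ⋯ O U_1 O U_0` on black-box `X`. -/
noncomputable def operator (X : BlackBox N) :
    Matrix (BasisState A.n A.w) (BasisState A.n A.w) ℂ :=
  Fin.induction (motive := fun _ => Matrix (BasisState A.n A.w) (BasisState A.n A.w) ℂ)
    (A.U 0 : Matrix (BasisState A.n A.w) (BasisState A.n A.w) ℂ)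
    (fun t B => (A.U t.succ : Matrix (BasisState A.n A.w) (BasisState A.n A.w) ℂ)
      * queryGate X A.n A.w * B)
    (Fin.last T)

/-- The final state on black-box `X`, for the initial state `|0, 0, 0⟩`. -/
noncomputable def finalState (X : BlackBox N) : BasisState A.n A.w → ℂ :=
  Matrix.mulVec (A.operator X) (Pi.single ((0, false, 0) : BasisState A.n A.w) 1)

/-- The acceptance probability on black-box `X`: the probability that the output qubit is observed
to be `1`. The answer qubit serves as output qubit; since `U_T` is arbitrary, any other choice
gives the same acceptance probabilities. -/
noncomputable def acceptProb (X : BlackBox N) : ℝ :=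
  ∑ s : BasisState A.n A.w, if s.2.1 = true then ‖A.finalState X s‖ ^ 2 else 0

/-- The error probability of the network on the worst-case black-box. -/
noncomputable def error : ℝ := BlackBox.worstCaseError A.acceptProb

end QuantumNetwork

/-- Deterministic classical query algorithms: `query j t₀ t₁` asks for `x_j` and goes on with
`t₀` if `x_j = 0` and with `t₁` if `x_j = 1`. -/
inductive DecisionTree (N : ℕ) : Type
  | leaf (answer : Bool) : DecisionTree N
  | query (j : Fin N) (t₀ t₁ : DecisionTree N) : DecisionTree N

namespace DecisionTree

/-- The output on black-box `X`. -/
def eval {N : ℕ} (X : BlackBox N) : DecisionTree N → Bool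
  | leaf a => a
  | query j t₀ t₁ => if X j = true then t₁.eval X else t₀.eval X

/-- The number of queries in the worst case. -/
def depth {N : ℕ} : DecisionTree N → ℕ
  | leaf _ => 0
  | query _ t₀ t₁ => max t₀.depth t₁.depth + 1

end DecisionTree

/-- A classical randomized algorithm that makes at most `k` queries: a probability distribution
on the deterministic algorithms that make at most `k` queries. -/
structure RandomizedAlgorithm (N k : ℕ) where
  dist : PMF (DecisionTree N)
  depth_le : ∀ t ∈ dist.support, t.depth ≤ k

namespace RandomizedAlgorithm

variable {N k : ℕ} (R : RandomizedAlgorithm N k)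

/-- The probability that the output on black-box `X` is `1`. -/
noncomputable def acceptProb (X : BlackBox N) : ℝ :=
  ((R.dist.map fun t => t.eval X) true).toReal

/-- The error probability of the algorithm on the worst-case black-box. -/
noncomputable def error : ℝ := BlackBox.worstCaseError R.acceptProb

end RandomizedAlgorithm

/-! The lower bounds use the polynomial method. Each query raises the degree of the amplitudes in
the items by at most one, so final amplitudes have degree at most `T`. Take the inner product of the
rejecting parts of the final states on the zero black-box and on `X` (`rejectOverlap`). The first
factor is constant, so the degree stays `T`. At `X = 0` the overlap is the rejection probability
`ρ`; if at least half of the items are ones, it is at most `√(ρ ε)` by Cauchy–Schwarz.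

Averaging over inputs of equal weight (`exists_polynomial_sum_powersetCard`) gives a univariate
polynomial of degree at most `T`, equal to `ρ` at `0` and at most `√(ρ ε)` in modulus at the
integers of `[N/2, N]`. Lagrange extrapolation (`norm_eval_zero_le`) yields `ρ ≤ 32 ^ T √(ρ ε)`,
hence `ρ ≤ 1024 ^ T ε`. As `ρ ≥ 1 - ε`, the error decays at most exponentially in `T`.

Classically, `k` independent uniform samples all miss the ones with probability at most `2 ^ (-k)`.
-/

/-! ### Extrapolation from equidistant nodes -/

/-- The product of the distances from `i` to the other elements of `{0, …, T}`. -/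
theorem prod_erase_abs_sub (T i : ℕ) (hi : i ≤ T) :
    ∏ j ∈ (Finset.range (T + 1)).erase i, |(i : ℝ) - j| = (i.factorial * (T - i).factorial : ℕ) := by
  have hsplit : (Finset.range (T + 1)).erase i
      = Finset.range i ∪ (Finset.range (T - i)).image (fun m => i + 1 + m) := by
    ext j
    simp only [Finset.mem_erase, Finset.mem_range, Finset.mem_union, Finset.mem_image]
    constructor
    · rintro ⟨h1, h2⟩
      rcases lt_or_gt_of_ne h1 with h | h
      · exact Or.inl h
      · exact Or.inr ⟨j - i - 1, by omega, by omega⟩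
    · rintro (h | ⟨m, h1, h2⟩) <;> omega
  have hdisj : Disjoint (Finset.range i) ((Finset.range (T - i)).image (fun m => i + 1 + m)) := by
    rw [Finset.disjoint_left]
    intro a ha hb
    simp only [Finset.mem_range, Finset.mem_image] at ha hb
    omega
  rw [hsplit, Finset.prod_union hdisj, Finset.prod_image (by intro a _ b _ h; simpa using h),
    ← Finset.prod_range_reflect, ← Finset.prod_range_add_one_eq_factorial i,
    ← Finset.prod_range_add_one_eq_factorial (T - i)]
  push_cast
  congr 1
  · refine Finset.prod_congr rfl fun j hj => ?_
    have hj' := Finset.mem_range.1 hj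
    rw [Nat.cast_sub (by omega), Nat.cast_sub (by omega), abs_of_nonneg] <;> push_cast
    · ring
    · have : (j : ℝ) ≥ 0 := by positivity
      linarith
  · refine Finset.prod_congr rfl fun j _ => ?_
    rw [abs_of_nonpos]
    · ring
    · have : (j : ℝ) ≥ 0 := by positivity
      linarith

/-- A single term of the exponential series gives `T ^ T / T! ≤ e ^ T`, and `e < 4`. -/
theorem pow_self_le_four_pow_mul_factorial (T : ℕ) : (T : ℝ) ^ T ≤ 4 ^ T * T.factorial := by
  have h := Real.pow_div_factorial_le_exp (T : ℝ) (by positivity) T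
  have h4 : Real.exp (T : ℝ) ≤ 4 ^ T := by
    rw [← Real.exp_one_pow]
    gcongr
    linarith [Real.exp_one_lt_d9]
  rw [div_le_iff₀ (by positivity)] at h
  exact h.trans (by gcongr)

/-- A polynomial of degree at most `T` is bounded at `0` by `32 ^ T` times its largest value at
`T + 1` equidistant nodes that span at least a constant fraction of their distance to `0`. -/
theorem norm_eval_zero_le (T N s : ℕ) (hs : 0 < s) (hlow : 2 * (s * T) ≤ N) (hN : T ≠ 0 → N ≤ 4 * (s * T))
    (P : Polynomial ℂ) (hP : P.degree ≤ T) (M : ℝ)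
    (hM : ∀ i ≤ T, ‖P.eval ((N - s * i : ℕ) : ℂ)‖ ≤ M) :
    ‖P.eval 0‖ ≤ 32 ^ T * M := by
  set v : ℕ → ℂ := fun i => (N : ℂ) - s * i with hv
  have hcast : ∀ i ≤ T, ((N - s * i : ℕ) : ℂ) = v i := by
    intro i hi
    have : s * i ≤ s * T := Nat.mul_le_mul_left s hi
    rw [Nat.cast_sub (by omega)]
    simp [hv]
  have hs0 : (s : ℂ) ≠ 0 := by exact_mod_cast hs.ne'
  have hinj : Set.InjOn v (Finset.range (T + 1)) := by
    intro i _ j _ h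
    have h' : (s : ℂ) * i = s * j := sub_right_injective h
    exact_mod_cast mul_left_cancel₀ hs0 h'
  have hsR : (0 : ℝ) < s := by exact_mod_cast hs
  have hM0 : 0 ≤ M := (norm_nonneg _).trans (hM 0 (Nat.zero_le _))
  -- Each factor is `|v j| / |v i - v j| ≤ 4 s T / (s |i - j|)`, so the spacing `s` cancels.
  have hbasis : ∀ i ∈ Finset.range (T + 1), ‖(Lagrange.basis (Finset.range (T + 1)) v i).eval 0‖
      ≤ (4 * T) ^ T / (i.factorial * (T - i).factorial : ℕ) := by
    intro i hi
    have hiT : i ≤ T := Nat.lt_succ_iff.1 (Finset.mem_range.1 hi)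
    rw [Lagrange.basis, Polynomial.eval_prod, norm_prod, ← prod_erase_abs_sub T i hiT]
    have hcard : ((Finset.range (T + 1)).erase i).card = T := by
      rw [Finset.card_erase_of_mem hi, Finset.card_range]; rfl
    rw [← hcard, ← Finset.prod_const, hcard, ← Finset.prod_div_distrib]
    refine Finset.prod_le_prod (fun _ _ => norm_nonneg _) fun j hj => ?_
    obtain ⟨hji, hj⟩ := Finset.mem_erase.1 hj
    have hjT : j ≤ T := Nat.lt_succ_iff.1 (Finset.mem_range.1 hj)
    have hT : T ≠ 0 := by omega
    have h1 : ‖v j‖ ≤ s * (4 * T) := by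
      rw [← hcast j hjT, Complex.norm_natCast]
      have := hN hT
      exact_mod_cast (by nlinarith [Nat.sub_le N (s * j)] : N - s * j ≤ s * (4 * T))
    have h2 : ‖v i - v j‖ = s * |(i : ℝ) - j| := by
      have : v i - v j = ((s * ((j : ℝ) - i) : ℝ) : ℂ) := by simp [hv]; ring
      rw [this, Complex.norm_real, Real.norm_eq_abs, abs_mul, abs_of_pos hsR, abs_sub_comm]
    have h3 : 0 < |(i : ℝ) - j| := abs_pos.2 (sub_ne_zero.2 (by exact_mod_cast hji.symm))
    simp only [Lagrange.basisDivisor, Polynomial.eval_mul, Polynomial.eval_C, Polynomial.eval_sub,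
      Polynomial.eval_X, norm_mul, norm_inv, zero_sub, norm_neg, h2]
    rw [inv_mul_eq_div, div_le_div_iff₀ (by positivity) h3]
    nlinarith
  have hdeg : P.degree < (Finset.range (T + 1)).card := by
    rw [Finset.card_range]
    exact lt_of_le_of_lt hP (by exact_mod_cast Nat.lt_succ_self T)
  have hfac : ∀ i ∈ Finset.range (T + 1), (4 * T : ℝ) ^ T / (i.factorial * (T - i).factorial : ℕ)
      = (4 * T : ℝ) ^ T / T.factorial * T.choose i := by
    intro i hi
    have hiT : i ≤ T := Nat.lt_succ_iff.1 (Finset.mem_range.1 hi)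
    have := Nat.choose_mul_factorial_mul_factorial hiT
    rw [div_mul_eq_mul_div, div_eq_div_iff (by positivity) (by positivity), ← this]
    push_cast
    ring
  have hchoose : ∑ i ∈ Finset.range (T + 1), (T.choose i : ℝ) = 2 ^ T := by
    exact_mod_cast Nat.sum_range_choose T
  rw [Lagrange.eq_interpolate hinj hdeg, Lagrange.interpolate_apply, Polynomial.eval_finsetSum]
  calc ‖∑ i ∈ Finset.range (T + 1), (Polynomial.C (P.eval (v i))
          * Lagrange.basis (Finset.range (T + 1)) v i).eval 0‖
      ≤ ∑ i ∈ Finset.range (T + 1), M * ((4 * T) ^ T / T.factorial * T.choose i) := by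
        refine norm_sum_le_of_le _ fun i hi => ?_
        rw [Polynomial.eval_mul, Polynomial.eval_C, norm_mul]
        have hiT : i ≤ T := Nat.lt_succ_iff.1 (Finset.mem_range.1 hi)
        refine mul_le_mul (hcast i hiT ▸ hM i hiT) ?_ (norm_nonneg _) hM0
        rw [← hfac i hi]
        exact hbasis i hi
    _ = (4 * T) ^ T / T.factorial * 2 ^ T * M := by
        rw [← Finset.mul_sum, ← Finset.mul_sum, hchoose]; ring
    _ ≤ 32 ^ T * M := by
        refine mul_le_mul_of_nonneg_right ?_ hM0
        -- The constant is `32 = 4 · 4 · 2`: distance ratio, `T ^ T / T!`, and the sum of binomials.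
        rw [div_mul_eq_mul_div, div_le_iff₀ (by positivity), mul_pow]
        calc (4 : ℝ) ^ T * T ^ T * 2 ^ T ≤ 4 ^ T * (4 ^ T * T.factorial) * 2 ^ T := by
              gcongr
              exact pow_self_le_four_pow_mul_factorial T
          _ = 32 ^ T * T.factorial := by
              rw [show (32 : ℝ) = 4 * 4 * 2 by norm_num, mul_pow, mul_pow]; ring

/-! ### Multilinear polynomials and symmetrization -/

namespace BlackBox

variable {N : ℕ}

/-- The monomial `∏_{i ∈ S} x_i`. -/
noncomputable def monomial (S : Finset (Fin N)) (X : BlackBox N) : ℂ :=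
  if ∀ i ∈ S, X i = true then 1 else 0

/-- The functions of black-boxes that are multilinear polynomials of degree at most `d`. -/
noncomputable def polyDegreeLE (N d : ℕ) : Submodule ℂ (BlackBox N → ℂ) :=
  Submodule.span ℂ (monomial '' {S : Finset (Fin N) | S.card ≤ d})

theorem polyDegreeLE_mono {d e : ℕ} (h : d ≤ e) : polyDegreeLE N d ≤ polyDegreeLE N e :=
  Submodule.span_mono (Set.image_mono fun _ hS => le_trans hS h)

theorem const_mem_polyDegreeLE (d : ℕ) (c : ℂ) : (fun _ => c) ∈ polyDegreeLE N d := by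
  have h : monomial (∅ : Finset (Fin N)) ∈ polyDegreeLE N d :=
    Submodule.subset_span ⟨∅, by simp, rfl⟩
  convert (polyDegreeLE N d).smul_mem c h using 1
  ext X
  simp [monomial]

/-- This is multiplication by `x_j`; since `x_j ^ 2 = x_j`, it inserts `j` into the index set of a
monomial. -/
theorem ite_mem_polyDegreeLE {d : ℕ} (j : Fin N) {f : BlackBox N → ℂ}
    (hf : f ∈ polyDegreeLE N d) :
    (fun X => if X j = true then f X else 0) ∈ polyDegreeLE N (d + 1) := by
  induction hf using Submodule.span_induction with
  | mem f hf =>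
    obtain ⟨S, hS, rfl⟩ := hf
    refine Submodule.subset_span ⟨insert j S, (Finset.card_insert_le _ _).trans (by simpa using hS), ?_⟩
    ext X
    by_cases hj : X j = true <;> simp [monomial, hj]
  | zero => simpa using const_mem_polyDegreeLE (d + 1) 0
  | add f g _ _ hf hg =>
    convert (polyDegreeLE N (d + 1)).add_mem hf hg using 1
    ext X
    by_cases hj : X j = true <;> simp [hj]
  | smul c f _ hf =>
    convert (polyDegreeLE N (d + 1)).smul_mem c hf using 1
    ext X
    by_cases hj : X j = true <;> simp [hj]

/-- The black-box whose ones are the elements of `U`. -/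
def ofFinset (U : Finset (Fin N)) : BlackBox N := fun i => decide (i ∈ U)

@[simp] theorem ones_ofFinset (U : Finset (Fin N)) : (ofFinset U).ones = U.card := by
  simp [ones, ofFinset]

theorem card_filter_powersetCard_superset (S : Finset (Fin N)) {w : ℕ} (hS : S.card ≤ w) :
    (((Finset.univ : Finset (Fin N)).powersetCard w).filter (S ⊆ ·)).card
      = (N - S.card).choose (w - S.card) := by
  have hc : (Finset.univ \ S).card = N - S.card := by
    rw [Finset.card_sdiff_of_subset (Finset.subset_univ _), Finset.card_univ, Fintype.card_fin]
  rw [← hc, ← Finset.card_powersetCard]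
  refine Finset.card_bij' (fun U _ => U \ S) (fun V _ => V ∪ S) ?_ ?_ ?_ ?_
  · intro U hU
    simp only [Finset.mem_filter, Finset.mem_powersetCard] at hU ⊢
    exact ⟨Finset.sdiff_subset_sdiff (Finset.subset_univ _) le_rfl,
      by rw [Finset.card_sdiff_of_subset hU.2, hU.1.2]⟩
  · intro V hV
    simp only [Finset.mem_filter, Finset.mem_powersetCard] at hV ⊢
    have hd : Disjoint V S := Finset.disjoint_of_subset_left hV.1 Finset.sdiff_disjoint
    refine ⟨⟨Finset.subset_univ _, ?_⟩, Finset.subset_union_right⟩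
    rw [Finset.card_union_of_disjoint hd, hV.2]
    omega
  · intro U hU
    exact Finset.sdiff_union_of_subset (Finset.mem_filter.1 hU).2
  · intro V hV
    have hd : Disjoint V S :=
      Finset.disjoint_of_subset_left (Finset.mem_powersetCard.1 hV).1 Finset.sdiff_disjoint
    exact Finset.union_sdiff_cancel_right hd

/-- Counts pairs of nested sets in two ways. The form without division also covers `w < S.card`,
where both sides vanish. -/
theorem sum_monomial_powersetCard (S : Finset (Fin N)) (w : ℕ) :
    (N.choose S.card : ℂ) * ∑ U ∈ (Finset.univ : Finset (Fin N)).powersetCard w,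
      monomial S (ofFinset U) = N.choose w * w.choose S.card := by
  have h : ∑ U ∈ (Finset.univ : Finset (Fin N)).powersetCard w, monomial S (ofFinset U)
      = ((((Finset.univ : Finset (Fin N)).powersetCard w).filter (S ⊆ ·)).card : ℂ) := by
    simp [monomial, ofFinset, Finset.subset_iff]
  rw [h]
  rcases le_or_gt S.card w with hw | hw
  · rw [card_filter_powersetCard_superset S hw]
    exact_mod_cast (Nat.choose_mul hw).symm
  · rw [Nat.choose_eq_zero_of_lt hw, Finset.filter_false_of_mem]
    · simp
    · intro U hU hSU
      have := Finset.card_le_card hSU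
      rw [(Finset.mem_powersetCard.1 hU).2] at this
      omega

/-- Symmetrization: the average of a multilinear polynomial of degree at most `d` over the
black-boxes with `w` ones is a polynomial of degree at most `d` in `w`. -/
theorem exists_polynomial_sum_powersetCard {d : ℕ} {f : BlackBox N → ℂ}
    (hf : f ∈ polyDegreeLE N d) :
    ∃ P : Polynomial ℂ, P.degree ≤ d ∧ ∀ w : ℕ,
      ∑ U ∈ (Finset.univ : Finset (Fin N)).powersetCard w, f (ofFinset U)
        = N.choose w * P.eval (w : ℂ) := by
  induction hf using Submodule.span_induction with
  | mem f hf =>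
    obtain ⟨S, hS, rfl⟩ := hf
    have hSN : S.card ≤ N := by simpa using S.card_le_univ
    have h0 : (N.choose S.card : ℂ) ≠ 0 := by exact_mod_cast (Nat.choose_pos hSN).ne'
    have h1 : (S.card.factorial : ℂ) ≠ 0 := by exact_mod_cast S.card.factorial_ne_zero
    -- With `m = S.card`, the average of the monomial is `w.choose m / N.choose m`, a scaled falling
    -- factorial in `w`.
    refine ⟨((S.card.factorial : ℂ) * N.choose S.card)⁻¹ • descPochhammer ℂ S.card,
      ?_, fun w => ?_⟩
    · refine (Polynomial.degree_smul_le _ _).trans (Polynomial.degree_le_of_natDegree_le ?_)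
      rw [descPochhammer_natDegree]
      exact hS
    · apply mul_left_cancel₀ h0
      rw [sum_monomial_powersetCard, Polynomial.eval_smul, smul_eq_mul,
        descPochhammer_eval_eq_descFactorial, Nat.descFactorial_eq_factorial_mul_choose]
      push_cast
      field_simp
  | zero => exact ⟨0, by simp, by simp⟩
  | add f g _ _ hf hg =>
    obtain ⟨P, hP, hfP⟩ := hf
    obtain ⟨Q, hQ, hgQ⟩ := hg
    refine ⟨P + Q, (Polynomial.degree_add_le _ _).trans (max_le hP hQ), fun w => ?_⟩
    simp only [Pi.add_apply, Finset.sum_add_distrib, hfP, hgQ, Polynomial.eval_add, mul_add]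
  | smul c f _ hf =>
    obtain ⟨P, hP, hfP⟩ := hf
    refine ⟨c • P, (Polynomial.degree_smul_le _ _).trans hP, fun w => ?_⟩
    simp only [Pi.smul_apply, smul_eq_mul, ← Finset.mul_sum, hfP, Polynomial.eval_smul]
    ring

theorem bddAbove_errorProb (p : BlackBox N → ℝ) :
    BddAbove (Set.range fun X : {X : BlackBox N // X.RPPromise} => errorProb p X.1) :=
  Set.Finite.bddAbove (Set.finite_range _)

theorem errorProb_le_worstCaseError (p : BlackBox N → ℝ) {X : BlackBox N} (hX : X.RPPromise) :
    errorProb p X ≤ worstCaseError p :=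
  le_ciSup (bddAbove_errorProb p) ⟨X, hX⟩

@[simp] theorem ones_zero : (zero N).ones = 0 := by simp [ones, zero]

end BlackBox

/-! ### Networks: norm preservation and degree -/

theorem queryMap_involutive {N : ℕ} (X : BlackBox N) {n w : ℕ} :
    Function.Involutive (queryMap X : BasisState n w → BasisState n w) := by
  rintro ⟨j, b, z⟩
  simp only [queryMap]
  split_ifs <;> simp

theorem queryGate_mulVec {N : ℕ} (X : BlackBox N) {n w : ℕ} (v : BasisState n w → ℂ)
    (r : BasisState n w) : (queryGate X n w).mulVec v r = v (queryMap X r) := by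
  have h : ∀ s, r = queryMap X s ↔ s = queryMap X r := fun s =>
    ⟨fun h => by rw [h, queryMap_involutive X s], fun h => by rw [h, queryMap_involutive X r]⟩
  simp [Matrix.mulVec, dotProduct, queryGate, h]

theorem sum_norm_sq_mulVec_of_mem_unitaryGroup {ι : Type*} [Fintype ι] [DecidableEq ι]
    (U : Matrix.unitaryGroup ι ℂ) (v : ι → ℂ) :
    ∑ i, ‖((U : Matrix ι ι ℂ).mulVec v) i‖ ^ 2 = ∑ i, ‖v i‖ ^ 2 := by
  have key : ∀ u : ι → ℂ, ((∑ i, ‖u i‖ ^ 2 : ℝ) : ℂ) = star u ⬝ᵥ u := by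
    intro u
    simp [dotProduct, Complex.conj_mul']
  apply Complex.ofReal_injective
  rw [key, key, Matrix.star_mulVec, Matrix.dotProduct_mulVec, Matrix.vecMul_vecMul,
    ← Matrix.star_eq_conjTranspose, Matrix.UnitaryGroup.star_mul_self, Matrix.vecMul_one]

namespace QuantumNetwork

variable {N T : ℕ} (A : QuantumNetwork N T)

/-- The state on black-box `X` after `t` queries and the unitary operation that follows them. -/
noncomputable def stateAfter (X : BlackBox N) (t : Fin (T + 1)) : BasisState A.n A.w → ℂ :=
  Matrix.mulVec (Fin.induction (motive := fun _ => Matrix (BasisState A.n A.w) (BasisState A.n A.w) ℂ)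
    (A.U 0 : Matrix (BasisState A.n A.w) (BasisState A.n A.w) ℂ)
    (fun t B => (A.U t.succ : Matrix (BasisState A.n A.w) (BasisState A.n A.w) ℂ)
      * queryGate X A.n A.w * B) t) (Pi.single ((0, false, 0) : BasisState A.n A.w) 1)

theorem stateAfter_zero (X : BlackBox N) :
    A.stateAfter X 0 = Matrix.mulVec (A.U 0 : Matrix (BasisState A.n A.w) (BasisState A.n A.w) ℂ)
      (Pi.single ((0, false, 0) : BasisState A.n A.w) 1) := rfl

theorem stateAfter_succ (X : BlackBox N) (t : Fin T) :
    A.stateAfter X t.succ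
      = Matrix.mulVec (A.U t.succ : Matrix (BasisState A.n A.w) (BasisState A.n A.w) ℂ)
        (Matrix.mulVec (queryGate X A.n A.w) (A.stateAfter X t.castSucc)) := by
  rw [stateAfter, Fin.induction_succ, ← Matrix.mulVec_mulVec, ← Matrix.mulVec_mulVec]
  rfl

theorem sum_norm_sq_finalState (X : BlackBox N) : ∑ s, ‖A.finalState X s‖ ^ 2 = 1 := by
  suffices h : ∀ t, ∑ s, ‖A.stateAfter X t s‖ ^ 2 = 1 from h (Fin.last T)
  intro t
  induction t using Fin.induction with
  | zero =>
    rw [stateAfter_zero, sum_norm_sq_mulVec_of_mem_unitaryGroup,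
      Finset.sum_eq_single ((0, false, 0) : BasisState A.n A.w)]
    · simp
    · intro s _ hs
      rw [Pi.single_eq_of_ne hs]
      simp
    · simp
  | succ t ih =>
    rw [stateAfter_succ, sum_norm_sq_mulVec_of_mem_unitaryGroup, ← ih]
    simp only [queryGate_mulVec]
    exact Equiv.sum_comp (queryMap_involutive X).toPerm fun s => ‖A.stateAfter X t.castSucc s‖ ^ 2

open BlackBox in
-- The query turns the amplitude `v_b` into `v_b + x_j (v_{!b} - v_b)`.
theorem queryGate_mulVec_mem_polyDegreeLE {n w d : ℕ} {v : BlackBox N → BasisState n w → ℂ}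
    (hv : ∀ s, (fun X => v X s) ∈ polyDegreeLE N d) (s : BasisState n w) :
    (fun X => (queryGate X n w).mulVec (v X) s) ∈ polyDegreeLE N (d + 1) := by
  obtain ⟨j, b, z⟩ := s
  have hle := polyDegreeLE_mono (N := N) (Nat.le_succ d)
  simp only [queryGate_mulVec, queryMap]
  by_cases hj : j.toNat < N
  · have h := (polyDegreeLE N (d + 1)).add_mem (hle (hv (j, b, z)))
      (ite_mem_polyDegreeLE ⟨j.toNat, hj⟩
        ((polyDegreeLE N d).sub_mem (hv (j, !b, z)) (hv (j, b, z))))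
    convert h using 1
    ext X
    by_cases hX : X ⟨j.toNat, hj⟩ = true <;> simp [hj, hX]
  · simpa [hj] using hle (hv (j, b, z))

open BlackBox in
-- The unitaries take linear combinations with coefficients independent of `X`, so only queries
-- raise the degree.
theorem stateAfter_mem_polyDegreeLE (t : Fin (T + 1)) :
    ∀ s, (fun X => A.stateAfter X t s) ∈ polyDegreeLE N t := by
  induction t using Fin.induction with
  | zero => exact fun s => const_mem_polyDegreeLE 0 (A.stateAfter (zero N) 0 s)
  | succ t ih =>
    intro s
    simp only [stateAfter_succ]
    change _ ∈ polyDegreeLE N (t + 1)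
    convert Submodule.sum_mem (polyDegreeLE N (t + 1)) (t := Finset.univ) fun r _ =>
      (polyDegreeLE N (t + 1)).smul_mem (A.U t.succ s r)
        (queryGate_mulVec_mem_polyDegreeLE ih r) using 1
    ext X
    rw [Finset.sum_apply]
    rfl

/-- Each amplitude of the final state is a multilinear polynomial of degree at most `T` in the
items of the black-box. -/
theorem finalState_mem_polyDegreeLE (s : BasisState A.n A.w) :
    (fun X => A.finalState X s) ∈ BlackBox.polyDegreeLE N T :=
  A.stateAfter_mem_polyDegreeLE (Fin.last T) s

/-! ### Rejection overlap and quantum lower bounds -/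

/-- The basis states on which the network rejects. -/
def rejecting : Finset (BasisState A.n A.w) := Finset.univ.filter fun s => ¬ s.2.1 = true

theorem sum_rejecting (X : BlackBox N) :
    ∑ s ∈ A.rejecting, ‖A.finalState X s‖ ^ 2 = 1 - A.acceptProb X := by
  rw [← A.sum_norm_sq_finalState X, acceptProb, rejecting, ← Finset.sum_filter,
    ← Finset.sum_filter_add_sum_filter_not Finset.univ (fun s : BasisState A.n A.w => s.2.1 = true)]
  ring

theorem errorProb_nonneg (X : BlackBox N) : 0 ≤ BlackBox.errorProb A.acceptProb X := by
  rw [BlackBox.errorProb, ← A.sum_rejecting]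
  split_ifs
  · exact Finset.sum_nonneg fun s _ => by positivity
  · exact Finset.sum_nonneg fun s _ => by positivity

theorem error_nonneg : 0 ≤ A.error :=
  (A.errorProb_nonneg (BlackBox.zero N)).trans
    (BlackBox.errorProb_le_worstCaseError _ (Or.inl BlackBox.ones_zero))

theorem acceptProb_zero_le_error : A.acceptProb (BlackBox.zero N) ≤ A.error := by
  have h := BlackBox.errorProb_le_worstCaseError A.acceptProb
    (X := BlackBox.zero N) (Or.inl BlackBox.ones_zero)
  rwa [BlackBox.errorProb, if_pos BlackBox.ones_zero] at h

/-- The overlap of the rejecting part of the final state with that on the black-box without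
ones. -/
noncomputable def rejectOverlap (X : BlackBox N) : ℂ :=
  ∑ s ∈ A.rejecting, star (A.finalState (BlackBox.zero N) s) * A.finalState X s

theorem rejectOverlap_mem_polyDegreeLE : A.rejectOverlap ∈ BlackBox.polyDegreeLE N T := by
  convert Submodule.sum_mem (BlackBox.polyDegreeLE N T) (t := A.rejecting) fun s _ =>
    (BlackBox.polyDegreeLE N T).smul_mem (star (A.finalState (BlackBox.zero N) s))
      (A.finalState_mem_polyDegreeLE s) using 1
  ext X
  simp [rejectOverlap, Finset.sum_apply]

theorem norm_rejectOverlap_le {X : BlackBox N} (hX : X.ones ≠ 0)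
    (hX' : (N : ℝ) / 2 ≤ (X.ones : ℝ)) :
    ‖A.rejectOverlap X‖ ≤ √((1 - A.acceptProb (BlackBox.zero N)) * A.error) := by
  apply Real.le_sqrt_of_sq_le
  have herr : 1 - A.acceptProb X ≤ A.error := by
    have h := BlackBox.errorProb_le_worstCaseError A.acceptProb (X := X) (Or.inr hX')
    rwa [BlackBox.errorProb, if_neg hX] at h
  calc ‖A.rejectOverlap X‖ ^ 2
      ≤ (∑ s ∈ A.rejecting, ‖A.finalState (BlackBox.zero N) s‖ * ‖A.finalState X s‖) ^ 2 := by
        gcongr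
        refine (norm_sum_le _ _).trans_eq ?_
        simp
    _ ≤ _ := Finset.sum_mul_sq_le_sq_mul_sq _ _ _
    _ ≤ _ := by
        rw [A.sum_rejecting, A.sum_rejecting]
        refine mul_le_mul_of_nonneg_left herr ?_
        rw [← A.sum_rejecting]
        exact Finset.sum_nonneg fun s _ => by positivity

/-- The probability of rejecting the black-box without ones is at most exponentially larger than
the error probability. -/
theorem one_sub_acceptProb_zero_le (hN : 1 ≤ N) (hT : 2 * T ≤ N) :
    1 - A.acceptProb (BlackBox.zero N) ≤ 1024 ^ T * A.error := by
  set ρ : ℝ := 1 - A.acceptProb (BlackBox.zero N) with hρ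
  have hρ0 : 0 ≤ ρ := by
    rw [hρ, ← A.sum_rejecting]
    exact Finset.sum_nonneg fun s _ => by positivity
  obtain ⟨P, hP, hsum⟩ := BlackBox.exists_polynomial_sum_powersetCard A.rejectOverlap_mem_polyDegreeLE
  have hP0 : ‖P.eval 0‖ = ρ := by
    have h := hsum 0
    have h0 : BlackBox.ofFinset (∅ : Finset (Fin N)) = BlackBox.zero N := by
      ext; simp [BlackBox.ofFinset, BlackBox.zero]
    simp only [Finset.powersetCard_zero, Finset.sum_singleton, h0, Nat.choose_zero_right,
      Nat.cast_one, one_mul, Nat.cast_zero] at h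
    rw [← h, rejectOverlap]
    have h1 : ∑ s ∈ A.rejecting, star (A.finalState (BlackBox.zero N) s)
        * A.finalState (BlackBox.zero N) s = (ρ : ℂ) := by
      rw [hρ, ← A.sum_rejecting]
      simp [Complex.conj_mul']
    rw [h1, Complex.norm_real, Real.norm_of_nonneg hρ0]
  have hPw : ∀ w : ℕ, w ≤ N → N ≤ 2 * w → ‖P.eval (w : ℂ)‖ ≤ √(ρ * A.error) := by
    intro w hw hNw
    have hpos : (0 : ℝ) < N.choose w := by exact_mod_cast Nat.choose_pos hw
    have h : ‖(N.choose w : ℂ) * P.eval (w : ℂ)‖ ≤ N.choose w * √(ρ * A.error) := by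
      rw [← hsum w]
      refine (norm_sum_le_of_le (f := fun U => A.rejectOverlap (BlackBox.ofFinset U))
        (n := fun _ => √(ρ * A.error)) _ fun U hU => ?_).trans_eq (by simp)
      have hc := (Finset.mem_powersetCard.1 hU).2
      apply A.norm_rejectOverlap_le
      · rw [BlackBox.ones_ofFinset, hc]
        omega
      · rw [BlackBox.ones_ofFinset, hc, div_le_iff₀ two_pos, mul_comm]
        exact_mod_cast hNw
    rw [norm_mul, Complex.norm_natCast] at h
    exact le_of_mul_le_mul_left h hpos
  -- The spacing is `⌊N / (2T)⌋`, which keeps the nodes in `[N/2, N]`; being at least `1`, it loses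
  -- at most a factor 2 to rounding. For `T = 0` there is one node and any positive spacing works.
  obtain ⟨s, hs, hlow, hup⟩ : ∃ s, 0 < s ∧ 2 * (s * T) ≤ N ∧ (T ≠ 0 → N ≤ 4 * (s * T)) := by
    rcases Nat.eq_zero_or_pos T with rfl | hT0
    · exact ⟨1, one_pos, by simp, by simp⟩
    · have h1 := Nat.div_pos hT (by omega : 0 < 2 * T)
      have h2 := Nat.div_mul_le_self N (2 * T)
      have h3 := Nat.lt_div_mul_add (a := N) (by omega : 0 < 2 * T)
      refine ⟨N / (2 * T), h1, by linarith, fun _ => ?_⟩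
      nlinarith
  have hmain := norm_eval_zero_le T N s hs hlow hup P hP (√(ρ * A.error)) fun i hi => by
    have : s * i ≤ s * T := Nat.mul_le_mul_left s hi
    exact hPw _ (Nat.sub_le _ _) (by omega)
  rw [hP0] at hmain
  -- If `ρ > 0`, squaring leaves a factor `ρ` to cancel.
  rcases hρ0.eq_or_lt with h | h
  · rw [← h]
    exact mul_nonneg (by positivity) A.error_nonneg
  · have hsq := pow_le_pow_left₀ hρ0 hmain 2
    rw [mul_pow, Real.sq_sqrt (mul_nonneg hρ0 A.error_nonneg), ← pow_mul, mul_comm T 2, pow_mul,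
      show (32 : ℝ) ^ 2 = 1024 by norm_num] at hsq
    refine le_of_mul_le_mul_left ?_ h
    linarith

theorem error_lower_bound (hN : 1 ≤ N) (hT : 2 * T ≤ N) :
    1 / 2 * Real.exp (-8 * √2 * (T : ℝ)) ≤ A.error := by
  have h1 := A.one_sub_acceptProb_zero_le hN hT
  have h2 := A.acceptProb_zero_le_error
  have h3 : (1024 : ℝ) ^ T * Real.exp (-8 * √2 * (T : ℝ)) ≤ 1 := by
    -- There is slack: `1024 < e ^ 10` and `8√2 > 11`.
    have h4 : (1024 : ℝ) ≤ Real.exp (8 * √2) := by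
      have h5 : (1.4 : ℝ) ≤ √2 := Real.le_sqrt_of_sq_le (by norm_num)
      calc (1024 : ℝ) ≤ 2.7 ^ 10 := by norm_num
        _ ≤ Real.exp 1 ^ 10 := by
            gcongr
            linarith [Real.exp_one_gt_d9]
        _ = Real.exp 10 := by rw [← Real.exp_nat_mul]; norm_num
        _ ≤ _ := Real.exp_le_exp.2 (by linarith)
    calc (1024 : ℝ) ^ T * Real.exp (-8 * √2 * (T : ℝ))
        ≤ Real.exp (8 * √2) ^ T * Real.exp (-8 * √2 * (T : ℝ)) := by gcongr
      _ = 1 := by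
          rw [← Real.exp_nat_mul, ← Real.exp_add, ← Real.exp_zero]
          congr 1
          ring
  have h6 : 1 ≤ (2 * 1024 ^ T) * A.error := by
    have : A.error ≤ 1024 ^ T * A.error :=
      le_mul_of_one_le_left A.error_nonneg (one_le_pow₀ (by norm_num))
    linarith
  calc 1 / 2 * Real.exp (-8 * √2 * (T : ℝ))
      ≤ 1 / 2 * Real.exp (-8 * √2 * (T : ℝ)) * ((2 * 1024 ^ T) * A.error) :=
        le_mul_of_one_le_right (by positivity) h6
    _ = (1024 ^ T * Real.exp (-8 * √2 * (T : ℝ))) * A.error := by ring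
    _ ≤ A.error := mul_le_of_le_one_left A.error_nonneg h3

/-- A network with small error probability makes many queries. -/
theorem le_ten_mul_queries {k : ℕ} (hk : k ≤ N)
    (h : 2 ≤ k ∨ A.acceptProb (BlackBox.zero N) = 0) (herr : A.error ≤ 1 / 2 ^ k) :
    k ≤ 10 * T := by
  rcases Nat.eq_zero_or_pos N with rfl | hN
  · omega
  by_contra! hlt
  have h1 := A.one_sub_acceptProb_zero_le hN (by omega)
  -- From `10 T + 1 ≤ k`; the extra `1` gives the factor 2, hence `ρ ≤ 1/2`. This contradicts `ρ ≥
  -- 3/4` if `2 ≤ k`, and `ρ = 1` if zero is never accepted.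
  have hpow : (1024 : ℝ) ^ T * 2 ≤ 2 ^ k := by
    rw [show (1024 : ℝ) = 2 ^ 10 by norm_num, ← pow_mul, ← pow_succ]
    exact pow_le_pow_right₀ (by norm_num) hlt
  have h2 : (1024 : ℝ) ^ T * A.error ≤ 1 / 2 := by
    calc (1024 : ℝ) ^ T * A.error ≤ (2 ^ k / 2) * (1 / 2 ^ k) := by
          refine mul_le_mul (by linarith) herr A.error_nonneg (by positivity)
      _ = 1 / 2 := by field_simp
  rcases h with h | h
  · have h3 : (1 : ℝ) / 2 ^ k ≤ 1 / 2 ^ 2 :=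
      one_div_le_one_div_of_le (by norm_num) (pow_le_pow_right₀ (by norm_num) h)
    have h4 := A.acceptProb_zero_le_error
    have h5 : (1 : ℝ) / 2 ^ 2 < 1 / 2 := by norm_num
    linarith
  · linarith

end QuantumNetwork

/-! ### Classical sampling -/

namespace DecisionTree

variable {N : ℕ}

/-- The algorithm that asks for the listed items and accepts iff one of them is `1`. -/
def anyOne : List (Fin N) → DecisionTree N
  | [] => leaf false
  | j :: l => query j (anyOne l) (leaf true)

theorem depth_anyOne_le (l : List (Fin N)) : (anyOne l).depth ≤ l.length := by
  induction l with
  | nil => simp [anyOne, depth]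
  | cons j l ih => simpa [anyOne, depth] using ih

theorem eval_anyOne (X : BlackBox N) (l : List (Fin N)) :
    (anyOne l).eval X = true ↔ ∃ j ∈ l, X j = true := by
  induction l with
  | nil => simp [anyOne, eval]
  | cons j l ih =>
    by_cases hj : X j = true <;> simp [anyOne, eval, hj, ih]

end DecisionTree

namespace RandomizedAlgorithm

variable {N : ℕ}

/-- The algorithm that asks for `k` independent uniformly random items and accepts iff one of them
is `1`. -/
noncomputable def sampling (N k : ℕ) [Nonempty (Fin N)] : RandomizedAlgorithm N k where
  dist := (PMF.uniformOfFintype (Fin k → Fin N)).map fun f => DecisionTree.anyOne (List.ofFn f)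
  depth_le t ht := by
    rw [PMF.mem_support_map_iff] at ht
    obtain ⟨f, -, rfl⟩ := ht
    simpa using DecisionTree.depth_anyOne_le (List.ofFn f)

theorem sampling_acceptProb (k : ℕ) [Nonempty (Fin N)] (X : BlackBox N) :
    (sampling N k).acceptProb X
      = ((Finset.univ.filter fun f : Fin k → Fin N => ∃ i, X (f i) = true).card : ℝ) / N ^ k := by
  have h : ∀ f : Fin k → Fin N, true = (DecisionTree.anyOne (List.ofFn f)).eval X
      ↔ ∃ i, X (f i) = true := by
    intro f
    rw [eq_comm, DecisionTree.eval_anyOne]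
    simp
  rw [acceptProb, sampling, PMF.map_comp, PMF.map_apply, tsum_fintype]
  simp only [Function.comp, h, PMF.uniformOfFintype_apply]
  rw [← Finset.sum_filter, Finset.sum_const]
  simp [div_eq_mul_inv]

theorem sampling_acceptProb_zero (k : ℕ) [Nonempty (Fin N)] :
    (sampling N k).acceptProb (BlackBox.zero N) = 0 := by
  simp [sampling_acceptProb, BlackBox.zero]

/-- Rejection means that all `k` samples, drawn with replacement, hit zeros. -/
theorem one_sub_sampling_acceptProb (k : ℕ) [Nonempty (Fin N)] (X : BlackBox N) :
    1 - (sampling N k).acceptProb X = ((N - X.ones : ℝ) / N) ^ k := by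
  have hN : (N : ℝ) ≠ 0 := by
    have := Fin.pos_iff_nonempty.2 ‹Nonempty (Fin N)›
    positivity
  have hsum := Finset.card_filter_add_card_filter_not (s := Finset.univ)
    (fun f : Fin k → Fin N => ∃ i, X (f i) = true)
  have hcard : (Finset.univ.filter fun f : Fin k → Fin N => ¬ ∃ i, X (f i) = true)
      = Fintype.piFinset fun _ : Fin k => Finset.univ.filter fun j => ¬ X j = true := by
    ext f
    simp
  have hzeros := Finset.card_filter_add_card_filter_not (s := Finset.univ) (fun j => X j = true)
  rw [hcard, Fintype.card_piFinset_const] at hsum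
  simp only [Finset.card_univ, Fintype.card_fun, Fintype.card_fin] at hsum hzeros
  have hz : ((Finset.univ.filter fun j => ¬ X j = true).card : ℝ) = N - X.ones := by
    rw [BlackBox.ones, eq_sub_iff_add_eq']
    exact_mod_cast hzeros
  have hsum' : ((Finset.univ.filter fun f : Fin k → Fin N => ∃ i, X (f i) = true).card : ℝ)
      + ((N : ℝ) - X.ones) ^ k = N ^ k := by
    rw [← hz]
    exact_mod_cast hsum
  rw [sampling_acceptProb, div_pow, ← hsum', eq_div_iff (by rw [hsum']; positivity), sub_mul,
    div_mul_cancel₀ _ (by rw [hsum']; positivity)]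
  ring

theorem sampling_error_le (k : ℕ) [Nonempty (Fin N)] : (sampling N k).error ≤ 1 / 2 ^ k := by
  have hN : (0 : ℝ) < N := by exact_mod_cast Fin.pos_iff_nonempty.2 ‹Nonempty (Fin N)›
  have : Nonempty {X : BlackBox N // X.RPPromise} :=
    ⟨⟨BlackBox.zero N, Or.inl BlackBox.ones_zero⟩⟩
  refine ciSup_le fun X => ?_
  rw [BlackBox.errorProb]
  split_ifs with h
  · have hX : X.1 = BlackBox.zero N := by
      ext i
      simpa [BlackBox.zero] using
        Finset.filter_eq_empty_iff.1 (Finset.card_eq_zero.1 h) (Finset.mem_univ i)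
    rw [hX, sampling_acceptProb_zero]
    positivity
  · have hX := X.2.resolve_left h
    have hle : (X.1.ones : ℝ) ≤ N := by
      have := (Finset.univ.filter fun i => X.1 i = true).card_le_univ
      rw [Fintype.card_fin] at this
      exact_mod_cast this
    rw [one_sub_sampling_acceptProb, ← one_div_pow]
    refine pow_le_pow_left₀ (div_nonneg (by linarith) hN.le) ?_ k
    rw [div_le_div_iff₀ hN two_pos]
    linarith

end RandomizedAlgorithm

/-! ### Assembly -/

theorem mainTheorem6 :
    (∀ b : ℝ, 0 < b → ∃ C : ℝ, 0 < C ∧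
      ∀ (N T : ℕ), 1 ≤ N → (T : ℝ) ≤ (N : ℝ) / 2 → ∀ A : QuantumNetwork N T,
        C * Real.exp (-8 * b * (T : ℝ) ^ 2 / (N : ℝ) - 8 * Real.sqrt 2 * (T : ℝ)) ≤ A.error) ∧
    (∃ c : ℝ, 0 < c ∧
      ∀ (k N T : ℕ), k ≤ N → ∀ A : QuantumNetwork N T,
        (2 ≤ k ∨ A.acceptProb (BlackBox.zero N) = 0) →
        A.error ≤ 1 / 2 ^ k → c * (k : ℝ) ≤ (T : ℝ)) ∧
    (∀ (N k : ℕ), 1 ≤ N → ∃ R : RandomizedAlgorithm N k,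
        R.acceptProb (BlackBox.zero N) = 0 ∧ R.error ≤ 1 / 2 ^ k) := by
  -- `C = 1/2` serves every `b`, as the term in `T ^ 2 / N` only weakens the bound; `c = 1/10` comes
  -- from `1024 = 2 ^ 10`.
  refine ⟨fun b hb => ⟨1 / 2, by norm_num, fun N T hN hT A => ?_⟩,
    ⟨1 / 10, by norm_num, fun k N T hk A h herr => ?_⟩, fun N k hN => ?_⟩
  · have hT' : 2 * T ≤ N := by
      have : (2 : ℝ) * T ≤ N := by linarith
      exact_mod_cast this
    refine le_trans ?_ (A.error_lower_bound hN hT')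
    gcongr
    have : 0 ≤ 8 * b * (T : ℝ) ^ 2 / N := by positivity
    have h : -8 * b * (T : ℝ) ^ 2 / N = -(8 * b * (T : ℝ) ^ 2 / N) := by ring
    rw [h]
    linarith
  · have : (k : ℝ) ≤ 10 * T := by exact_mod_cast A.le_ten_mul_queries hk h herr
    linarith
  · have : Nonempty (Fin N) := Fin.pos_iff_nonempty.1 hN
    exact ⟨RandomizedAlgorithm.sampling N k, RandomizedAlgorithm.sampling_acceptProb_zero k,
      RandomizedAlgorithm.sampling_error_le k⟩
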